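/- Let $\mathbb F$ be a finite field. A $q$-matroid is a pair $\mathcal M=(E,\rho)$, where $E$ is a finite-dimensional $\mathbb F$-vector space and $\rho$ maps the subspaces of $E$ to $\mathbb N_{\ge 0}$ such that, for all subspaces $V,W\le E$: $\rho(V)\le\dim V$; $V\le W$ implies $\rho(V)\le\rho(W)$; and $\rho(V+W)+\rho(V\cap W)\le\rho(V)+\rho(W)$. Two $q$-matroids $(E_1,\rho_1)$, $(E_2,\rho_2)$ are equivalent, written $\approx$, if there is an $\mathbb F$-linear isomorphism $\alpha:E_1\to E_2$ with $\rho_2(\alpha(V))=\rho_1(V)$ for all $V\le E_1$. The direct sum $\mathcal M_1\oplus\mathcal M_2$ of $\mathcal M_i=(E_i,\rho_i)$ is the $q$-matroid on $E_1\oplus E_2$ with rank function $$\rho(V)=\dim V+\min_{X\le V}\bigl(\rho_1(\pi_1(X))+\rho_2(\pi_2(X))-\dim X\bigr),$$ where $\pi_i$ is the projection onto $E_i$; direct sums of finitely many $q$-matroids are formed by iteration, the empty direct sum being the $q$-matroid on the zero space. A $q$-matroid is reducible if it is equivalent to a direct sum of two $q$-matroids with nonzero ground spaces, and irreducible otherwise.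 Theorem. Let $\mathcal M$ be a $q$-matroid. Then there are $t\ge 0$ and irreducible $q$-matroids $\mathcal M_1,\dots,\mathcal M_t$ with nonzero ground spaces such that $\mathcal M\approx\mathcal M_1\oplus\cdots\oplus\mathcal M_t$. The summands are unique up to ordering and equivalence: if also $\mathcal M\approx\mathcal N_1\oplus\cdots\oplus\mathcal N_s$ with irreducible $q$-matroids $\mathcal N_j$ with nonzero ground spaces, then there is a bijection $\sigma:\{1,\dots,t\}\to\{1,\dots,s\}$ such that $\mathcal M_i\approx\mathcal N_{\sigma(i)}$ for all $i$. -/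

import Mathlib

universe u v w

open Module

/-- A `q`-matroid with ground space `E` (a vector space over `F`): a rank function on the lattice
of all subspaces of `E` that is bounded by the dimension, monotone and submodular. -/
structure QMatroid (F : Type u) (E : Type v) [Field F] [AddCommGroup E] [Module F E] where
  rank : Submodule F E → ℕ
  rank_le_finrank : ∀ V, rank V ≤ finrank F V
  rank_mono : ∀ V W, V ≤ W → rank V ≤ rank W
  rank_submod : ∀ V W, rank (V ⊔ W) + rank (V ⊓ W) ≤ rank V + rank W

namespace QMatroid

variable {F : Type u} [Field F]
variable {E : Type v} [AddCommGroup E] [Module F E]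
variable {E' : Type w} [AddCommGroup E'] [Module F E']

/-- Two `q`-matroids are equivalent if some linear isomorphism of the ground spaces preserves the
rank of every subspace. -/
def IsEquivalent (M : QMatroid F E) (M' : QMatroid F E') : Prop :=
  ∃ α : E ≃ₗ[F] E', ∀ V : Submodule F E, M'.rank (V.map (α : E →ₗ[F] E')) = M.rank V

/-- The `q`-matroid on `E'` with rank function `V ↦ M.rank (f V)`. For `f` a projection of a
direct sum onto the summand `E`, this adds the other summand to `M` as a space of rank `0`. -/
def pullback [FiniteDimensional F E'] (M : QMatroid F E) (f : E' →ₗ[F] E) : QMatroid F E' where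
  rank V := M.rank (V.map f)
  rank_le_finrank V := (M.rank_le_finrank _).trans (Submodule.finrank_map_le f V)
  rank_mono V W h := M.rank_mono _ _ (Submodule.map_mono h)
  rank_submod V W := by
    rw [Submodule.map_sup]
    exact (Nat.add_le_add_left (M.rank_mono _ _ (Submodule.map_inf_le f)) _).trans
      (M.rank_submod _ _)

/-- The rank function of the union of two `q`-matroids on `E`:
`ρ(V) = dim V + min {ρ₁(X) + ρ₂(X) - dim X | X ≤ V}`. The difference `dim V - dim X` is a
truncated one, which is harmless because `X ≤ V`. -/
noncomputable def unionRank (M₁ M₂ : QMatroid F E) (V : Submodule F E) : ℕ :=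
  ⨅ X : Set.Iic V, (M₁.rank X + M₂.rank X + (finrank F V - finrank F X.1))

theorem unionRank_le (M₁ M₂ : QMatroid F E) {V X : Submodule F E} (h : X ≤ V) :
    M₁.unionRank M₂ V ≤ M₁.rank X + M₂.rank X + (finrank F V - finrank F X) :=
  ciInf_le (OrderBot.bddBelow _) (⟨X, h⟩ : Set.Iic V)

theorem exists_unionRank_eq (M₁ M₂ : QMatroid F E) (V : Submodule F E) :
    ∃ X ≤ V, M₁.unionRank M₂ V =
      M₁.rank X + M₂.rank X + (finrank F V - finrank F X) := by
  obtain ⟨X, hX⟩ := ciInf_mem (fun X : Set.Iic V =>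
    M₁.rank X + M₂.rank X + (finrank F V - finrank F X.1))
  exact ⟨X.1, X.2, hX.symm⟩

/-- The union of two `q`-matroids on the same ground space. -/
noncomputable def union [FiniteDimensional F E] (M₁ M₂ : QMatroid F E) : QMatroid F E where
  rank := M₁.unionRank M₂
  rank_le_finrank V := by
    have h := M₁.unionRank_le M₂ (bot_le : ⊥ ≤ V)
    have h₁ := M₁.rank_le_finrank ⊥
    have h₂ := M₂.rank_le_finrank ⊥
    rw [finrank_bot] at h h₁ h₂
    omega
  rank_mono V W hVW := by
    obtain ⟨X, hX, h⟩ := M₁.exists_unionRank_eq M₂ W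
    have h' := M₁.unionRank_le M₂ (inf_le_left : V ⊓ X ≤ V)
    have h₁ := M₁.rank_mono _ _ (inf_le_right : V ⊓ X ≤ X)
    have h₂ := M₂.rank_mono _ _ (inf_le_right : V ⊓ X ≤ X)
    have h₃ := Submodule.finrank_sup_add_finrank_inf_eq V X
    have h₄ := Submodule.finrank_mono (sup_le hVW hX)
    omega
  rank_submod V W := by
    obtain ⟨X, hX, hV⟩ := M₁.exists_unionRank_eq M₂ V
    obtain ⟨Y, hY, hW⟩ := M₁.exists_unionRank_eq M₂ W
    have h₁ := M₁.unionRank_le M₂ (sup_le_sup hX hY)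
    have h₂ := M₁.unionRank_le M₂ (inf_le_inf hX hY)
    have h₃ := M₁.rank_submod X Y
    have h₄ := M₂.rank_submod X Y
    have h₅ := Submodule.finrank_sup_add_finrank_inf_eq V W
    have h₆ := Submodule.finrank_sup_add_finrank_inf_eq X Y
    have h₇ := Submodule.finrank_mono hX
    have h₈ := Submodule.finrank_mono hY
    have h₉ := Submodule.finrank_mono (sup_le_sup hX hY)
    have h₁₀ := Submodule.finrank_mono (inf_le_inf hX hY)
    omega

/-- The direct sum of two `q`-matroids: add each ground space to the other `q`-matroid as a space
of rank `0`, and take the union of the two resulting `q`-matroids on `E × E'`. -/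
noncomputable def directSum [FiniteDimensional F E] [FiniteDimensional F E']
    (M : QMatroid F E) (M' : QMatroid F E') : QMatroid F (E × E') :=
  (M.pullback (LinearMap.fst F E E')).union (M'.pullback (LinearMap.snd F E E'))

/-- A `q`-matroid is reducible if it is, up to equivalence, the direct sum of two `q`-matroids
with nonzero finite-dimensional ground spaces. -/
def IsReducible (M : QMatroid F E) : Prop :=
  ∃ (E₁ E₂ : Type v) (_ : AddCommGroup E₁) (_ : AddCommGroup E₂) (_ : Module F E₁)
    (_ : Module F E₂) (_ : FiniteDimensional F E₁) (_ : FiniteDimensional F E₂)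
    (M₁ : QMatroid F E₁) (M₂ : QMatroid F E₂),
    Nontrivial E₁ ∧ Nontrivial E₂ ∧ M.IsEquivalent (M₁.directSum M₂)

/-- A `q`-matroid is irreducible if it is not reducible. -/
def IsIrreducible (M : QMatroid F E) : Prop := ¬ M.IsReducible

/-- The `q`-matroid all of whose subspaces have rank `0`. -/
def trivial (F : Type u) (E : Type v) [Field F] [AddCommGroup E] [Module F E] : QMatroid F E where
  rank _ := 0
  rank_le_finrank _ := Nat.zero_le _
  rank_mono _ _ _ := le_rfl
  rank_submod _ _ := le_rfl

end QMatroid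

/-- A `q`-matroid over `F` together with its finite-dimensional ground space. -/
structure BundledQMatroid (F : Type u) [Field F] where
  Ground : Type v
  [addCommGroup : AddCommGroup Ground]
  [module : Module F Ground]
  [finiteDimensional : FiniteDimensional F Ground]
  toQMatroid : QMatroid F Ground

namespace BundledQMatroid

attribute [instance] addCommGroup module finiteDimensional

variable {F : Type u} [Field F]

/-- The iterated direct sum `N₁ ⊕ (N₂ ⊕ (⋯ ⊕ Nₜ))` of a list of `q`-matroids; the empty sum is the
`q`-matroid on the zero space. -/
noncomputable def directSum : List (BundledQMatroid.{u, v} F) → BundledQMatroid.{u, v} F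
  | [] => ⟨PUnit, QMatroid.trivial F PUnit⟩
  | N :: L => ⟨N.Ground × (directSum L).Ground, N.toQMatroid.directSum (directSum L).toQMatroid⟩

end BundledQMatroid

/-- `L` is a decomposition of `M` into irreducible `q`-matroids: all members of `L` are irreducible
with nonzero ground space, and `M` is equivalent to their direct sum. -/
def QMatroid.IsIrreducibleDecomposition {F : Type u} [Field F] {E : Type v} [AddCommGroup E]
    [Module F E] (M : QMatroid F E) (L : List (BundledQMatroid.{u, v} F)) : Prop :=
  (∀ N ∈ L, Nontrivial N.Ground ∧ N.toQMatroid.IsIrreducible) ∧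
    M.IsEquivalent (BundledQMatroid.directSum L).toQMatroid

/-! Existence is induction on the dimension. For uniqueness, both decompositions are carried into
the one space `E`, as independent families `A`, `B` of inseparable subspaces along which the rank is
given by the direct sum formula. Only one inequality of that formula has to be required: the other
holds in every q-matroid.

Let `L` be the largest subspace of rank 0. An inseparable nonzero `P` is either a line or a cyclic
subspace with `P ⊓ L = ⊥` (`IsInseparable.isAtom_or`). In the second case, if `P` is a summand, `P ⊔
L` is a cyclic flat, and a cyclic flat is the sum of its intersections with the summands of any
internal decomposition (`eq_iSup_inf`). Since `P` is inseparable, all but one of these pieces lie in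
`L` (`le_loops_or`), so `P ≤ B j ⊔ L` for some `j`. By symmetry `A i ⊔ L = B j ⊔ L`. The subspaces
`A i` and `B j` themselves may differ, but both are complements of `L` in the same space and ranks
depend only on images modulo `L`, so they are equivalent.

The lines are counted. Those of rank 0 number `dim L`, because `L` is itself a cyclic flat; the
number of all lines follows by comparing dimensions. -/

section LinearAlgebra

/-! ### Independent families of subspaces -/

variable {F : Type u} [Field F] {E : Type v} [AddCommGroup E] [Module F E]

/-- In a direct sum of two subspaces, sums of subspaces of the summands intersect componentwise. -/
theorem Submodule.sup_inf_sup_le_of_disjoint {A B P Q C D : Submodule F E} (h : Disjoint A B)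
    (hP : P ≤ A) (hQ : Q ≤ B) (hC : C ≤ A) (hD : D ≤ B) :
    (P ⊔ Q) ⊓ (C ⊔ D) ≤ (P ⊓ C) ⊔ (Q ⊓ D) := by
  rintro x ⟨hx, hx'⟩
  obtain ⟨p, hp, q, hq, rfl⟩ := Submodule.mem_sup.1 hx
  obtain ⟨c, hc, d, hd, hcd⟩ := Submodule.mem_sup.1 hx'
  have h0 : p - c = d - q := by
    rw [sub_eq_sub_iff_add_eq_add, ← hcd, add_comm]
  have h1 : p - c = 0 := Submodule.disjoint_def.1 h _ (sub_mem (hP hp) (hC hc))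
    (h0 ▸ sub_mem (hD hd) (hQ hq))
  have h2 : p = c := sub_eq_zero.1 h1
  have h3 : q = d := (sub_eq_zero.1 (h0 ▸ h1)).symm
  exact Submodule.add_mem_sup ⟨hp, h2 ▸ hc⟩ ⟨hq, h3 ▸ hd⟩

theorem Submodule.finrank_iSup_of_iSupIndep [FiniteDimensional F E] {ι : Type*} [Fintype ι]
    {V : ι → Submodule F E} (hV : iSupIndep V) :
    finrank F (⨆ i, V i : Submodule F E) = ∑ i, finrank F (V i) := by
  classical
  have key (s : Finset ι) : finrank F (s.sup V : Submodule F E) = ∑ i ∈ s, finrank F (V i) := by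
    induction s using Finset.induction_on with
    | empty => simp
    | insert a s ha ih =>
      have hd : Disjoint (V a) (s.sup V) :=
        (hV.supIndep' (insert a s)) (Finset.subset_insert a s) (Finset.mem_insert_self a s) ha
      have h := Submodule.finrank_sup_add_finrank_inf_eq (V a) (s.sup V)
      rw [hd.eq_bot, finrank_bot, add_zero] at h
      rw [Finset.sup_insert, Finset.sum_insert ha, h, ih]
  rw [← Finset.sup_univ_eq_iSup, key]

theorem iSupIndep_finCons {n : ℕ} {a : Submodule F E} {B : Fin n → Submodule F E}
    (hB : iSupIndep B) (h : Disjoint a (⨆ i, B i)) :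
    iSupIndep (Fin.cons a B : Fin (n + 1) → Submodule F E) := by
  intro i
  refine Fin.cases ?_ (fun i => ?_) i
  · refine h.mono_right (iSup₂_le fun j hj => ?_)
    obtain ⟨k, rfl⟩ := Fin.exists_succ_eq.2 hj
    exact le_iSup B k
  · have h1 : (⨆ (j) (_ : j ≠ i.succ), (Fin.cons a B : Fin (n + 1) → Submodule F E) j) ≤
        a ⊔ ⨆ (j) (_ : j ≠ i), B j := by
      refine iSup₂_le fun j => Fin.cases (fun _ => le_sup_left) (fun k hk => ?_) j
      exact le_sup_of_le_right (le_iSup₂_of_le k (fun h => hk (h ▸ rfl)) le_rfl)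
    refine Disjoint.mono_right h1 ?_
    rw [Fin.cons_succ, sup_comm]
    refine Disjoint.disjoint_sup_right_of_disjoint_sup_left (hB i) ?_
    exact (h.mono_right (sup_le (le_iSup B i) (iSup₂_le fun j _ => le_iSup B j))).symm

end LinearAlgebra

/-! ### Loops, cyclic subspaces, flats and separation -/

namespace QMatroid

variable {F : Type u} [Field F] {E : Type v} [AddCommGroup E] [Module F E]

theorem rank_bot (M : QMatroid F E) : M.rank ⊥ = 0 := by
  simpa using M.rank_le_finrank ⊥

theorem rank_sup_le (M : QMatroid F E) (V W : Submodule F E) :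
    M.rank (V ⊔ W) ≤ M.rank V + M.rank W := by
  have := M.rank_submod V W
  omega

theorem rank_iSup_le (M : QMatroid F E) {ι : Type*} [Fintype ι] (V : ι → Submodule F E) :
    M.rank (⨆ i, V i) ≤ ∑ i, M.rank (V i) := by
  classical
  have key (s : Finset ι) : M.rank (s.sup V) ≤ ∑ i ∈ s, M.rank (V i) := by
    induction s using Finset.induction_on with
    | empty => simp [rank_bot]
    | insert a s ha ih =>
      rw [Finset.sup_insert, Finset.sum_insert ha]
      exact (M.rank_sup_le _ _).trans (Nat.add_le_add_left ih _)
  rw [← Finset.sup_univ_eq_iSup]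
  exact key _

/-- The largest subspace of rank `0`. -/
def loops (M : QMatroid F E) : Submodule F E := sSup {V | M.rank V = 0}

theorem le_loops {M : QMatroid F E} {V : Submodule F E} (h : M.rank V = 0) : V ≤ M.loops :=
  le_sSup h

/-- A subspace is cyclic if its rank does not drop by one on any of its hyperplanes. -/
def IsCyclic (M : QMatroid F E) (V : Submodule F E) : Prop :=
  ∀ X < V, M.rank V + finrank F X < M.rank X + finrank F V

/-- A subspace is a flat if every proper extension has larger rank. -/
def IsFlat (M : QMatroid F E) (V : Submodule F E) : Prop :=
  ∀ W, V ≤ W → M.rank W = M.rank V → W ≤ V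

/-- The rank function on the span of the subspaces `C` and `D` is that of the direct sum of the
restrictions to `C` and `D`. -/
def Separates (M : QMatroid F E) (C D : Submodule F E) : Prop :=
  ∀ V ≤ C ⊔ D, ∃ C' ≤ C, ∃ D' ≤ D,
    M.rank C' + M.rank D' + finrank F V ≤ M.rank V + finrank F (V ⊓ (C' ⊔ D') : Submodule F E)

/-- A subspace on which the restriction of a `q`-matroid is not a direct sum of two nonzero
summands. -/
def IsInseparable (M : QMatroid F E) (P : Submodule F E) : Prop :=
  ∀ C D, C ⊔ D = P → Disjoint C D → M.Separates C D → C = ⊥ ∨ D = ⊥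

/-- The `q`-matroid is the internal direct sum of its restrictions to the subspaces `A i`. -/
structure IsInternalSum (M : QMatroid F E) {ι : Type*} [Fintype ι]
    (A : ι → Submodule F E) : Prop where
  indep : iSupIndep A
  iSup_eq_top : ⨆ i, A i = ⊤
  exists_le : ∀ V : Submodule F E, ∃ A' : ι → Submodule F E, (∀ i, A' i ≤ A i) ∧
    ∑ i, M.rank (A' i) + finrank F V ≤ M.rank V + finrank F (V ⊓ ⨆ i, A' i : Submodule F E)

variable [FiniteDimensional F E]

theorem rank_add_finrank_le (M : QMatroid F E) {V W : Submodule F E} (h : V ≤ W) :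
    M.rank W + finrank F V ≤ M.rank V + finrank F W := by
  obtain ⟨U, hd, rfl⟩ := IsModularLattice.exists_disjoint_and_sup_eq h
  have h1 := M.rank_sup_le V U
  have h2 := M.rank_le_finrank U
  have h3 := Submodule.finrank_sup_add_finrank_inf_eq V U
  rw [hd.eq_bot, finrank_bot] at h3
  omega

/-- Subspaces of rank 0 are closed under sums, so by finite dimension their supremum is one of them.
-/
theorem rank_loops (M : QMatroid F E) : M.rank M.loops = 0 := by
  refine CompleteLattice.WellFoundedGT.isSupClosedCompact (Submodule F E) inferInstance
    {V | M.rank V = 0} ⟨⊥, M.rank_bot⟩ ?_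
  intro V hV W hW
  have := M.rank_sup_le V W
  simp only [Set.mem_ofPred_eq] at hV hW ⊢
  omega

theorem le_loops_iff {M : QMatroid F E} {V : Submodule F E} : V ≤ M.loops ↔ M.rank V = 0 := by
  refine ⟨fun h => ?_, le_loops⟩
  have := M.rank_mono _ _ h
  rw [rank_loops] at this
  omega

/-- The rank thus depends only on the image modulo the loops. -/
theorem rank_sup_loops (M : QMatroid F E) (V : Submodule F E) :
    M.rank (V ⊔ M.loops) = M.rank V := by
  have h1 := M.rank_sup_le V M.loops
  have h2 := M.rank_mono _ _ (le_sup_left : V ≤ V ⊔ M.loops)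
  rw [rank_loops] at h1
  omega

variable {M : QMatroid F E}

/-- Witnesses for `A`, `B` can be cut down to `C`, `D`, because components in a direct sum are
unique. -/
theorem Separates.mono {A B C D : Submodule F E} (h : M.Separates A B) (hAB : Disjoint A B)
    (hC : C ≤ A) (hD : D ≤ B) : M.Separates C D := by
  intro V hV
  obtain ⟨A', hA', B', hB', hV'⟩ := h V (hV.trans (sup_le_sup hC hD))
  refine ⟨C ⊓ A', inf_le_left, D ⊓ B', inf_le_left, ?_⟩
  have h1 := M.rank_mono _ _ (inf_le_right : C ⊓ A' ≤ A')
  have h2 := M.rank_mono _ _ (inf_le_right : D ⊓ B' ≤ B')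
  have h3 : V ⊓ (A' ⊔ B') ≤ V ⊓ (C ⊓ A' ⊔ D ⊓ B') :=
    le_inf inf_le_left ((inf_le_inf_right _ hV).trans
      (Submodule.sup_inf_sup_le_of_disjoint hAB hC hD hA' hB'))
  have h4 := Submodule.finrank_mono h3
  omega

theorem Separates.rank_sup {C D : Submodule F E} (h : M.Separates C D) (hCD : Disjoint C D) :
    M.rank (C ⊔ D) = M.rank C + M.rank D := by
  refine le_antisymm (M.rank_sup_le C D) ?_
  obtain ⟨C', hC, D', hD, h⟩ := h _ le_rfl
  rw [inf_eq_right.2 (sup_le_sup hC hD)] at h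
  have h1 := M.rank_add_finrank_le hC
  have h2 := M.rank_add_finrank_le hD
  have h3 := Submodule.finrank_sup_add_finrank_inf_eq C D
  have h4 := Submodule.finrank_sup_add_finrank_inf_eq C' D'
  rw [hCD.eq_bot, finrank_bot] at h3
  rw [(hCD.mono hC hD).eq_bot, finrank_bot] at h4
  omega

omit [FiniteDimensional F E] in
/-- A subspace of rank `0` is a direct summand. -/
theorem separates_of_rank_eq_zero {C D : Submodule F E} (h : M.rank C = 0) : M.Separates C D := by
  intro V hV
  -- By modularity the two witnesses span `V ⊔ C`, and adding `C` to `V` does not raise the rank.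
  refine ⟨C, le_rfl, (V ⊔ C) ⊓ D, inf_le_right, ?_⟩
  have h1 : C ⊔ (V ⊔ C) ⊓ D = V ⊔ C := by
    rw [inf_comm, ← sup_inf_assoc_of_le _ (le_sup_right : C ≤ V ⊔ C), inf_eq_right]
    exact sup_le hV le_sup_left
  rw [h1, inf_eq_left.2 (le_sup_left : V ≤ V ⊔ C)]
  have h2 := M.rank_mono _ _ (inf_le_left : (V ⊔ C) ⊓ D ≤ V ⊔ C)
  have h3 := M.rank_sup_le V C
  omega

/-- Subspaces witnessing that `P` is not cyclic are direct summands of `P`. -/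
theorem separates_of_rank_add_finrank_le {X D : Submodule F E}
    (h : M.rank X + finrank F (X ⊔ D : Submodule F E) ≤ M.rank (X ⊔ D) + finrank F X) :
    M.Separates X D := by
  intro V hV
  -- From `X` to `X ⊔ D` the rank grows by the full dimension, hence also from `X` to `V ⊔ X`, and
  -- by submodularity from `V ⊓ X` to `V`. So `D` need not contribute.
  refine ⟨V ⊓ X, inf_le_right, ⊥, bot_le, ?_⟩
  rw [sup_bot_eq, inf_eq_right.2 inf_le_left, rank_bot]
  have h1 := M.rank_submod V X
  have h2 := M.rank_add_finrank_le (sup_le hV le_sup_left : V ⊔ X ≤ X ⊔ D)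
  have h3 := Submodule.finrank_sup_add_finrank_inf_eq V X
  omega

/-- A rank-0 subspace and a subspace witnessing non-cyclicity both split off. If `P` meets the
loops, then `P` lies in them and each of its subspaces splits off, so `P` is a line. If `P` is not
cyclic, the witness must be `⊥`; then `P` has full rank, every proper subspace is a witness, and `P`
is again a line. -/
theorem IsInseparable.isAtom_or {P : Submodule F E} (h : M.IsInseparable P) (hP : P ≠ ⊥) :
    (IsAtom P ∧ M.rank P ≤ 1) ∨ (P ⊓ M.loops = ⊥ ∧ M.IsCyclic P) := by
  by_cases hatom : IsAtom P
  · refine Or.inl ⟨hatom, ?_⟩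
    rw [← Submodule.isAtom_iff_finrank_eq_one.1 hatom]
    exact M.rank_le_finrank P
  refine Or.inr ⟨?_, ?_⟩
  · by_contra hL
    have key (C : Submodule F E) (hC : C ≠ ⊥) (hCP : C ≤ P) (hCL : C ≤ M.loops) : C = P := by
      obtain ⟨D, hd, hsup⟩ := IsModularLattice.exists_disjoint_and_sup_eq hCP
      rcases h C D hsup hd (separates_of_rank_eq_zero (le_loops_iff.1 hCL)) with h | h
      · exact absurd h hC
      · rw [← hsup, h, sup_bot_eq]
    have hPL : P ≤ M.loops := inf_eq_left.1 (key _ hL inf_le_left inf_le_right)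
    refine hatom ⟨hP, fun C hC => ?_⟩
    by_contra hC0
    exact hC.ne (key C hC0 hC.le (hC.le.trans hPL))
  · by_contra hc
    have key (X : Submodule F E) (hX : X < P)
        (hr : M.rank X + finrank F P ≤ M.rank P + finrank F X) : X = ⊥ := by
      obtain ⟨D, hd, rfl⟩ := IsModularLattice.exists_disjoint_and_sup_eq hX.le
      rcases h X D rfl hd (separates_of_rank_add_finrank_le hr) with h | h
      · exact h
      · rw [h, sup_bot_eq] at hX
        exact absurd rfl hX.ne
    unfold IsCyclic at hc
    push Not at hc
    obtain ⟨X, hX, hr⟩ := hc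
    obtain rfl := key X hX hr
    rw [rank_bot, finrank_bot] at hr
    refine hatom ⟨hP, fun Y hY => key Y hY ?_⟩
    have := M.rank_le_finrank Y
    omega

theorem isFlat_loops (M : QMatroid F E) : M.IsFlat M.loops := by
  intro W _ hr
  rw [rank_loops] at hr
  exact le_loops hr

theorem isCyclic_loops (M : QMatroid F E) : M.IsCyclic M.loops := by
  intro X hX
  have := Submodule.finrank_lt_finrank_of_lt hX
  rw [rank_loops]
  omega

/-- Adding loops to `X` keeps its rank, and `X ⊔ L` is recovered from its trace on `P`, to which
cyclicity of `P` applies. -/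
theorem IsCyclic.sup_loops {P : Submodule F E} (hP : M.IsCyclic P) (hL : P ⊓ M.loops = ⊥) :
    M.IsCyclic (P ⊔ M.loops) := by
  intro X hX
  set L := M.loops with hLdef
  have hr : M.rank (P ⊔ L) = M.rank P := M.rank_sup_loops P
  have hX' : X ⊔ L ≤ P ⊔ L := sup_le hX.le le_sup_right
  have hrX : M.rank (X ⊔ L) = M.rank X := M.rank_sup_loops X
  have hY : (X ⊔ L) ⊓ P ⊔ L = X ⊔ L := by
    rw [inf_sup_assoc_of_le _ (le_sup_right : L ≤ X ⊔ L), inf_eq_left]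
    exact hX'
  have hlt := Submodule.finrank_lt_finrank_of_lt hX
  -- If the trace is all of `P`, then `X` already has the full rank in smaller dimension.
  rcases (inf_le_right : (X ⊔ L) ⊓ P ≤ P).eq_or_lt with h | h
  · rw [h] at hY
    rw [← hrX, ← hY]
    omega
  · have h1 := hP _ h
    have h2 := M.rank_mono _ _ (inf_le_left : (X ⊔ L) ⊓ P ≤ X ⊔ L)
    have h3 := Submodule.finrank_sup_add_finrank_inf_eq ((X ⊔ L) ⊓ P) L
    have h4 := Submodule.finrank_sup_add_finrank_inf_eq P L
    have h5 := Submodule.finrank_mono (le_sup_left : X ≤ X ⊔ L)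
    rw [hL, finrank_bot] at h4
    rw [hY, inf_assoc, hL, inf_bot_eq, finrank_bot] at h3
    omega

/-- Restricting the decomposition of a subspace to a complement of the loops in it. -/
theorem IsInseparable.le_loops_or {P C D : Submodule F E} (h : M.IsInseparable P)
    (hL : P ⊓ M.loops = ⊥) (hCD : Disjoint C D) (hsup : C ⊔ D = P ⊔ M.loops)
    (hLCD : M.loops ≤ (C ⊓ M.loops) ⊔ (D ⊓ M.loops)) (hs : M.Separates C D) :
    C ≤ M.loops ∨ D ≤ M.loops := by
  set L := M.loops with hLdef
  -- `(X ⊔ L) ⊓ P` is the projection of `X` to `P` along the loops; its rank is at most that of `X`.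
  have hsupL (X : Submodule F E) (hX : X ≤ P ⊔ L) : (X ⊔ L) ⊓ P ⊔ L = X ⊔ L := by
    rw [inf_sup_assoc_of_le _ (le_sup_right : L ≤ X ⊔ L), inf_eq_left]
    exact sup_le hX le_sup_right
  have hr (X : Submodule F E) : M.rank ((X ⊔ L) ⊓ P) ≤ M.rank X :=
    (M.rank_mono _ _ inf_le_left).trans (M.rank_sup_loops X).le
  have hC : C ≤ P ⊔ L := hsup ▸ le_sup_left
  have hD : D ≤ P ⊔ L := hsup ▸ le_sup_right
  -- Since the loops split along `C` and `D`, adding them to `C` only adds loops of `D`, and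
  -- conversely.
  have hinf : (C ⊔ L) ⊓ (D ⊔ L) ≤ L := by
    have h1 : C ⊔ L ≤ C ⊔ (D ⊓ L) :=
      sup_le le_sup_left (hLCD.trans (sup_le_sup_right inf_le_left _))
    have h2 : D ⊔ L ≤ (C ⊓ L) ⊔ D :=
      sup_le le_sup_right (hLCD.trans (sup_le_sup_left inf_le_left _))
    refine (inf_le_inf h1 h2).trans ((Submodule.sup_inf_sup_le_of_disjoint hCD le_rfl inf_le_left
      inf_le_left le_rfl).trans (sup_le ?_ ?_))
    · exact inf_le_right.trans inf_le_right
    · exact inf_le_left.trans inf_le_right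
  have hle (X Y : Submodule F E) (hX : X ≤ P ⊔ L) (hY : Y ≤ P ⊔ L) :
      (X ⊔ Y) ⊓ P ≤ (X ⊔ L) ⊓ P ⊔ (Y ⊔ L) ⊓ P := by
    have h1 : X ⊔ Y ≤ ((X ⊔ L) ⊓ P ⊔ (Y ⊔ L) ⊓ P) ⊔ L := by
      refine sup_le ?_ ?_
      · exact (le_sup_left.trans (hsupL X hX).ge).trans (sup_le_sup_right le_sup_left _)
      · exact (le_sup_left.trans (hsupL Y hY).ge).trans (sup_le_sup_right le_sup_right _)
    refine (inf_le_inf_right P h1).trans ?_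
    rw [sup_inf_assoc_of_le _ (sup_le inf_le_right inf_le_right), inf_comm L P, hL, sup_bot_eq]
  -- The projections of `C` and `D` form a separation of `P`, so one of them is zero.
  have key := h ((C ⊔ L) ⊓ P) ((D ⊔ L) ⊓ P)
    (le_antisymm (sup_le inf_le_right inf_le_right) (by
      have := hle C D hC hD
      rwa [hsup, inf_eq_right.2 le_sup_left] at this))
    (by
      rw [disjoint_iff, eq_bot_iff, ← hL]
      exact le_inf (inf_le_left.trans inf_le_right)
        ((inf_le_inf inf_le_left inf_le_left).trans hinf))
    (by
      intro V hV
      have hVP : V ≤ P := hV.trans (sup_le inf_le_right inf_le_right)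
      obtain ⟨C', hC', D', hD', hV'⟩ := hs V (hVP.trans (hsup ▸ le_sup_left))
      refine ⟨(C' ⊔ L) ⊓ P, inf_le_inf_right _ (sup_le_sup_right hC' _),
        (D' ⊔ L) ⊓ P, inf_le_inf_right _ (sup_le_sup_right hD' _), ?_⟩
      have h1 : V ⊓ (C' ⊔ D') ≤ V ⊓ ((C' ⊔ L) ⊓ P ⊔ (D' ⊔ L) ⊓ P) :=
        le_inf inf_le_left ((le_inf inf_le_right (inf_le_left.trans hVP)).trans
          (hle _ _ (hC'.trans hC) (hD'.trans hD)))
      have h2 := Submodule.finrank_mono h1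
      have h3 := hr C'
      have h4 := hr D'
      omega)
  refine key.imp (fun h0 => ?_) (fun h0 => ?_)
  · have := hsupL C hC
    rw [h0, bot_sup_eq] at this
    exact this ▸ le_sup_left
  · have := hsupL D hD
    rw [h0, bot_sup_eq] at this
    exact this ▸ le_sup_left

/-! ### Cyclic flats in an internal direct sum -/

namespace IsInternalSum

variable {ι : Type*} [Fintype ι] {A : ι → Submodule F E}

omit [FiniteDimensional F E] in
-- For witnesses `A'` of the rank formula at `V`, cyclicity forces `V ≤ ⨆ i, A' i` without loss of
-- rank, and flatness turns this into an equality.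
theorem eq_iSup_inf (h : M.IsInternalSum A) {V : Submodule F E} (hc : M.IsCyclic V)
    (hf : M.IsFlat V) : V = ⨆ i, V ⊓ A i := by
  obtain ⟨A', hA', hV⟩ := h.exists_le V
  have h1 := M.rank_iSup_le A'
  have h2 := M.rank_mono _ _ (inf_le_right : V ⊓ ⨆ i, A' i ≤ _)
  have h3 : V ⊓ ⨆ i, A' i = V := by
    by_contra hne
    have := hc _ (lt_of_le_of_ne inf_le_left hne)
    omega
  have h4 : V ≤ ⨆ i, A' i := inf_eq_left.1 h3
  have h5 := M.rank_mono _ _ h4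
  rw [h3] at hV
  have h6 : ⨆ i, A' i ≤ V := hf _ h4 (by omega)
  refine le_antisymm (h4.trans (iSup_mono fun i => le_inf ?_ (hA' i)))
    (iSup_le fun i => inf_le_left)
  exact (le_iSup A' i).trans h6

omit [FiniteDimensional F E] in
theorem separates (h : M.IsInternalSum A) (i : ι) :
    M.Separates (A i) (⨆ (j) (_ : j ≠ i), A j) := by
  classical
  intro V _
  obtain ⟨A', hA', hV⟩ := h.exists_le V
  refine ⟨A' i, hA' i, ⨆ (j) (_ : j ≠ i), A' j, iSup₂_mono fun j _ => hA' j, ?_⟩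
  rw [← iSup_split_single A' i]
  have h1 : M.rank (⨆ (j) (_ : j ≠ i), A' j) ≤ ∑ j ∈ Finset.univ.erase i, M.rank (A' j) := by
    have h2 := M.rank_iSup_le (fun j : {j // j ≠ i} => A' j)
    rw [iSup_subtype] at h2
    refine h2.trans (le_of_eq ?_)
    rw [← Finset.sum_subtype (Finset.univ.erase i) (by simp) (fun j => M.rank (A' j))]
  have h3 := Finset.add_sum_erase Finset.univ (fun j => M.rank (A' j)) (Finset.mem_univ i)
  omega

omit [FiniteDimensional F E] in
theorem sup_iSup_ne (h : M.IsInternalSum A) (i : ι) : A i ⊔ ⨆ (j) (_ : j ≠ i), A j = ⊤ := by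
  rw [← iSup_split_single A i, h.iSup_eq_top]

/-- An extension `W` of the same rank is `A i` plus its trace on the other summands; ranks add, so
that trace has rank 0. -/
theorem isFlat_sup_loops (h : M.IsInternalSum A) (i : ι) : M.IsFlat (A i ⊔ M.loops) := by
  intro W hW hr
  have hd := h.indep i
  set B := ⨆ (j) (_ : j ≠ i), A j with hB
  have hAW : A i ≤ W := le_sup_left.trans hW
  have h1 : A i ⊔ (B ⊓ W) = W := by
    rw [← sup_inf_assoc_of_le _ hAW, h.sup_iSup_ne i, top_inf_eq]
  have h2 := ((h.separates i).mono hd le_rfl (inf_le_left : B ⊓ W ≤ B)).rank_sup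
    (hd.mono_right inf_le_left)
  rw [h1, hr, rank_sup_loops] at h2
  rw [← h1]
  exact sup_le_sup_left (le_loops (by omega)) _

theorem rank_sup_of_ne (h : M.IsInternalSum A) {i j : ι} (hij : i ≠ j) :
    M.rank (A i ⊔ A j) = M.rank (A i) + M.rank (A j) := by
  have hle : A j ≤ ⨆ (k) (_ : k ≠ i), A k := le_iSup₂_of_le j hij.symm le_rfl
  exact ((h.separates i).mono (h.indep i) le_rfl hle).rank_sup ((h.indep i).mono_right hle)

theorem eq_of_le_sup_loops (h : M.IsInternalSum A) {i j : ι} (hr : M.rank (A i) ≠ 0)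
    (hle : A i ≤ A j ⊔ M.loops) : i = j := by
  by_contra hij
  have h1 := h.rank_sup_of_ne hij
  have h2 := M.rank_mono _ _ (sup_le hle le_sup_left : A i ⊔ A j ≤ A j ⊔ M.loops)
  rw [rank_sup_loops] at h2
  omega

/-- An inseparable summand without loops and coloops is determined modulo the loops. -/
theorem exists_le_sup_loops {P : Submodule F E} (h : M.IsInternalSum A) (hP : M.IsInseparable P)
    (hP0 : P ≠ ⊥) (hL : P ⊓ M.loops = ⊥) (hc : M.IsCyclic (P ⊔ M.loops))
    (hf : M.IsFlat (P ⊔ M.loops)) :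
    ∃ j, ¬ A j ≤ M.loops ∧ P ≤ A j ⊔ M.loops ∧ (IsAtom (A j) → A j ≤ P ⊔ M.loops) := by
  set L := M.loops with hLdef
  have h1 := h.eq_iSup_inf hc hf
  have h2 : L = ⨆ i, L ⊓ A i := h.eq_iSup_inf M.isCyclic_loops M.isFlat_loops
  -- Otherwise `P` would lie in the loops, which it meets trivially.
  obtain ⟨j, hj⟩ : ∃ j, ¬ (P ⊔ L) ⊓ A j ≤ L := by
    by_contra! hall
    have : P ≤ L := le_sup_left.trans (h1.le.trans (iSup_le hall))
    exact hP0 (by rwa [inf_eq_left.2 this] at hL)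
  have hCA : (P ⊔ L) ⊓ A j ≤ A j := inf_le_right
  have hDB : ⨆ (k) (_ : k ≠ j), (P ⊔ L) ⊓ A k ≤ ⨆ (k) (_ : k ≠ j), A k :=
    iSup₂_mono fun k _ => inf_le_right
  have hsup := iSup_split_single (fun k => (P ⊔ L) ⊓ A k) j
  rw [← h1] at hsup
  have hLi (i : ι) : L ⊓ A i ≤ (P ⊔ L) ⊓ A i := inf_le_inf_right _ le_sup_right
  refine ⟨j, fun hle => hj (inf_le_right.trans hle), ?_, fun hat => ?_⟩
  · have := hP.le_loops_or hL ((h.indep j).mono hCA hDB) hsup.symm (by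
      change L ≤ _
      conv_lhs => rw [h2, iSup_split_single _ j]
      refine sup_le_sup (le_inf (hLi j) inf_le_left) (le_inf ?_ ?_)
      · exact iSup₂_mono fun k _ => hLi k
      · exact iSup₂_le fun k _ => inf_le_left)
      ((h.separates j).mono (h.indep j) hCA hDB)
    have hD := this.resolve_left hj
    refine le_sup_left.trans (hsup.le.trans (sup_le_sup hCA hD))
  -- The piece in `A j` is nonzero, so it fills `A j` if that is a line.
  · rcases hat.le_iff.1 hCA with h0 | h0
    · exact absurd (h0 ▸ bot_le) hj
    · exact inf_eq_right.1 h0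

theorem finrank_eq_sum (h : M.IsInternalSum A) : finrank F E = ∑ i, finrank F (A i) := by
  rw [← Submodule.finrank_iSup_of_iSupIndep h.indep, h.iSup_eq_top, finrank_top]

theorem finrank_loops_eq_sum (h : M.IsInternalSum A) :
    finrank F M.loops = ∑ i, finrank F (M.loops ⊓ A i : Submodule F E) := by
  rw [← Submodule.finrank_iSup_of_iSupIndep (h.indep.mono fun i => inf_le_right),
    ← h.eq_iSup_inf M.isCyclic_loops M.isFlat_loops]

end IsInternalSum

end QMatroid

/-! ### Dimension formulas and linear isomorphisms -/

section LinearAlgebra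

variable {F : Type u} [Field F] {E : Type v} [AddCommGroup E] [Module F E]
variable {E' : Type w} [AddCommGroup E'] [Module F E']

/-- This bounds the cost of shrinking a witness, so that rank formulas of nested direct sums can be
chained. -/
theorem Submodule.finrank_inf_add_finrank_le [FiniteDimensional F E] (V : Submodule F E)
    {Y Y' : Submodule F E} (h : Y' ≤ Y) :
    finrank F (V ⊓ Y : Submodule F E) + finrank F Y' ≤
      finrank F (V ⊓ Y' : Submodule F E) + finrank F Y := by
  have h1 := Submodule.finrank_sup_add_finrank_inf_eq (V ⊓ Y) Y'
  rw [inf_assoc, inf_eq_right.2 h] at h1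
  have h2 := Submodule.finrank_mono (sup_le inf_le_right h : V ⊓ Y ⊔ Y' ≤ Y)
  omega

theorem LinearMap.finrank_map_eq_of_injective {f : E →ₗ[F] E'} (hf : Function.Injective f)
    (V : Submodule F E) : finrank F (V.map f) = finrank F V :=
  (Submodule.equivMapOfInjective f hf V).finrank_eq.symm

theorem Submodule.finrank_prod_eq [FiniteDimensional F E] [FiniteDimensional F E']
    (A : Submodule F E) (B : Submodule F E') :
    finrank F (A.prod B) = finrank F A + finrank F B := by
  have h := Submodule.finrank_sup_add_finrank_inf_eq (A.map (LinearMap.inl F E E'))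
    (B.map (LinearMap.inr F E E'))
  rwa [(LinearMap.isCompl_range_inl_inr.disjoint.mono LinearMap.map_le_range
    LinearMap.map_le_range).eq_bot, finrank_bot, add_zero, ← LinearMap.prod_eq_sup_map,
    LinearMap.finrank_map_eq_of_injective LinearMap.inl_injective,
    LinearMap.finrank_map_eq_of_injective LinearMap.inr_injective] at h

theorem LinearEquiv.finrank_comap_eq (α : E ≃ₗ[F] E') (W : Submodule F E') :
    finrank F (W.comap (α : E →ₗ[F] E')) = finrank F W := by
  rw [← α.finrank_map_eq, Submodule.map_comap_eq_of_surjective α.surjective]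

theorem LinearEquiv.finrank_map_inf (α : E ≃ₗ[F] E') (V : Submodule F E) (W : Submodule F E') :
    finrank F (V.map (α : E →ₗ[F] E') ⊓ W : Submodule F E') =
      finrank F (V ⊓ W.comap (α : E →ₗ[F] E') : Submodule F E) := by
  rw [← α.finrank_map_eq, Submodule.map_inf _ α.injective,
    Submodule.map_comap_eq_of_surjective α.surjective]

theorem LinearMap.exists_linearEquiv_of_range_eq {X Y : Type*} [AddCommGroup X] [Module F X]
    [AddCommGroup Y] [Module F Y] {f : X →ₗ[F] E} {g : Y →ₗ[F] E} (hf : Function.Injective f)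
    (hg : Function.Injective g) (h : LinearMap.range f = LinearMap.range g) :
    ∃ e : X ≃ₗ[F] Y, g ∘ₗ (e : X →ₗ[F] Y) = f := by
  refine ⟨(LinearEquiv.ofInjective f hf).trans ((LinearEquiv.ofEq _ _ h).trans
    (LinearEquiv.ofInjective g hg).symm), LinearMap.ext fun x => ?_⟩
  have := LinearEquiv.apply_symm_apply (LinearEquiv.ofInjective g hg)
    (LinearEquiv.ofEq _ _ h (LinearEquiv.ofInjective f hf x))
  exact congrArg Subtype.val this

end LinearAlgebra

/-! ### Equivalence and the rank formula of direct sums -/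

namespace QMatroid

variable {F : Type u} [Field F] {E : Type*} [AddCommGroup E] [Module F E]
variable {E₁ : Type*} [AddCommGroup E₁] [Module F E₁]
variable {E₂ : Type*} [AddCommGroup E₂] [Module F E₂]
variable {E₃ : Type*} [AddCommGroup E₃] [Module F E₃]
variable {E₄ : Type*} [AddCommGroup E₄] [Module F E₄]

theorem IsEquivalent.refl (M : QMatroid F E) : M.IsEquivalent M :=
  ⟨LinearEquiv.refl F E, fun V => by simp⟩

theorem IsEquivalent.symm {M : QMatroid F E} {M₁ : QMatroid F E₁} (h : M.IsEquivalent M₁) :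
    M₁.IsEquivalent M := by
  obtain ⟨α, h⟩ := h
  refine ⟨α.symm, fun V => ?_⟩
  rw [← h, ← Submodule.map_comp]
  simp

theorem IsEquivalent.trans {M : QMatroid F E} {M₁ : QMatroid F E₁} {M₂ : QMatroid F E₂}
    (h : M.IsEquivalent M₁) (h' : M₁.IsEquivalent M₂) : M.IsEquivalent M₂ := by
  obtain ⟨α, h⟩ := h
  obtain ⟨β, h'⟩ := h'
  refine ⟨α.trans β, fun V => ?_⟩
  rw [← h, ← h', ← Submodule.map_comp]
  rfl

variable [FiniteDimensional F E] [FiniteDimensional F E₁] [FiniteDimensional F E₂]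
  [FiniteDimensional F E₃] [FiniteDimensional F E₄]

theorem rank_add_finrank_inf_le (M : QMatroid F E) (V W : Submodule F E) :
    M.rank V + finrank F (V ⊓ W : Submodule F E) ≤ M.rank W + finrank F V :=
  (M.rank_add_finrank_le inf_le_left).trans
    (Nat.add_le_add_right (M.rank_mono _ _ inf_le_right) _)

/-- With `exists_le_directSum_rank`, this makes the rank a minimum over pairs `(A, B)`, with `V ⊓
A.prod B` as the subspace `X` of the definition. Pairs are easier to transport. -/
theorem directSum_rank_le (M₁ : QMatroid F E₁) (M₂ : QMatroid F E₂) (A : Submodule F E₁)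
    (B : Submodule F E₂) (V : Submodule F (E₁ × E₂)) :
    (M₁.directSum M₂).rank V + finrank F (V ⊓ A.prod B : Submodule F (E₁ × E₂)) ≤
      M₁.rank A + M₂.rank B + finrank F V := by
  have h := unionRank_le (M₁.pullback (LinearMap.fst F E₁ E₂))
    (M₂.pullback (LinearMap.snd F E₁ E₂)) (inf_le_left : V ⊓ A.prod B ≤ V)
  have h1 : M₁.rank ((V ⊓ A.prod B).map (LinearMap.fst F E₁ E₂)) ≤ M₁.rank A :=
    M₁.rank_mono _ _ (Submodule.map_le_iff_le_comap.2 fun x hx => hx.2.1)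
  have h2 : M₂.rank ((V ⊓ A.prod B).map (LinearMap.snd F E₁ E₂)) ≤ M₂.rank B :=
    M₂.rank_mono _ _ (Submodule.map_le_iff_le_comap.2 fun x hx => hx.2.2)
  have h3 := Submodule.finrank_mono (inf_le_left : V ⊓ A.prod B ≤ V)
  change (M₁.directSum M₂).rank V ≤ M₁.rank _ + M₂.rank _ + _ at h
  omega

theorem directSum_rank_prod_le (M₁ : QMatroid F E₁) (M₂ : QMatroid F E₂) (A : Submodule F E₁)
    (B : Submodule F E₂) : (M₁.directSum M₂).rank (A.prod B) ≤ M₁.rank A + M₂.rank B := by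
  have h := directSum_rank_le M₁ M₂ A B (A.prod B)
  rw [inf_idem] at h
  omega

theorem exists_le_directSum_rank (M₁ : QMatroid F E₁) (M₂ : QMatroid F E₂)
    (V : Submodule F (E₁ × E₂)) : ∃ A B, M₁.rank A + M₂.rank B + finrank F V ≤
      (M₁.directSum M₂).rank V + finrank F (V ⊓ A.prod B : Submodule F (E₁ × E₂)) := by
  obtain ⟨X, hX, h⟩ := exists_unionRank_eq (M₁.pullback (LinearMap.fst F E₁ E₂))
    (M₂.pullback (LinearMap.snd F E₁ E₂)) V
  refine ⟨X.map (LinearMap.fst F E₁ E₂), X.map (LinearMap.snd F E₁ E₂), ?_⟩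
  change (M₁.directSum M₂).rank V = M₁.rank _ + M₂.rank _ + _ at h
  have h1 : X ≤ V ⊓ (X.map (LinearMap.fst F E₁ E₂)).prod (X.map (LinearMap.snd F E₁ E₂)) :=
    fun x hx => ⟨hX hx, ⟨x, hx, rfl⟩, ⟨x, hx, rfl⟩⟩
  have h2 := Submodule.finrank_mono h1
  omega

omit [FiniteDimensional F E] in
-- The two inequalities characterise the rank of a direct sum.
theorem isEquivalent_directSum {M : QMatroid F E} {M₁ : QMatroid F E₁} {M₂ : QMatroid F E₂}
    (α : E ≃ₗ[F] E₁ × E₂)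
    (h₁ : ∀ (V : Submodule F E) (A : Submodule F E₁) (B : Submodule F E₂), M.rank V +
      finrank F (V ⊓ (A.prod B).comap (α : E →ₗ[F] E₁ × E₂) : Submodule F E) ≤
        M₁.rank A + M₂.rank B + finrank F V)
    (h₂ : ∀ V : Submodule F E, ∃ (A : Submodule F E₁) (B : Submodule F E₂),
      M₁.rank A + M₂.rank B + finrank F V ≤ M.rank V +
      finrank F (V ⊓ (A.prod B).comap (α : E →ₗ[F] E₁ × E₂) : Submodule F E)) :
    M.IsEquivalent (M₁.directSum M₂) := by
  refine ⟨α, fun V => ?_⟩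
  obtain ⟨A, B, hAB⟩ := h₂ V
  obtain ⟨A', B', hAB'⟩ := exists_le_directSum_rank M₁ M₂ (V.map (α : E →ₗ[F] E₁ × E₂))
  have h3 := directSum_rank_le M₁ M₂ A B (V.map (α : E →ₗ[F] E₁ × E₂))
  have h4 := h₁ V A' B'
  rw [α.finrank_map_inf, α.finrank_map_eq] at h3 hAB'
  omega

theorem IsEquivalent.directSum_congr {M₁ : QMatroid F E₁} {M₂ : QMatroid F E₂}
    {M₃ : QMatroid F E₃} {M₄ : QMatroid F E₄} (h : M₁.IsEquivalent M₃)
    (h' : M₂.IsEquivalent M₄) : (M₁.directSum M₂).IsEquivalent (M₃.directSum M₄) := by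
  obtain ⟨β, hβ⟩ := h
  obtain ⟨γ, hγ⟩ := h'
  have hc (A : Submodule F E₃) (B : Submodule F E₄) :
      (A.prod B).comap (β.prodCongr γ : E₁ × E₂ →ₗ[F] E₃ × E₄) =
        (A.comap (β : E₁ →ₗ[F] E₃)).prod (B.comap (γ : E₂ →ₗ[F] E₄)) := rfl
  refine isEquivalent_directSum (β.prodCongr γ) (fun V A B => ?_) (fun V => ?_)
  · have h := directSum_rank_le M₁ M₂ (A.comap (β : E₁ →ₗ[F] E₃)) (B.comap (γ : E₂ →ₗ[F] E₄)) V
    rw [← hβ, ← hγ, Submodule.map_comap_eq_of_surjective β.surjective,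
      Submodule.map_comap_eq_of_surjective γ.surjective] at h
    rwa [hc]
  · obtain ⟨A, B, h⟩ := exists_le_directSum_rank M₁ M₂ V
    refine ⟨A.map (β : E₁ →ₗ[F] E₃), B.map (γ : E₂ →ₗ[F] E₄), ?_⟩
    rw [hc, Submodule.comap_map_eq_of_injective β.injective,
      Submodule.comap_map_eq_of_injective γ.injective, hβ, hγ]
    exact h

theorem isEquivalent_directSum_trivial (M : QMatroid F E) [Unique E₁] :
    M.IsEquivalent (M.directSum (trivial F E₁)) := by
  have hc (A : Submodule F E) (B : Submodule F E₁) :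
      (A.prod B).comap ((LinearEquiv.prodUnique (R := F) (M := E) (M₂ := E₁)).symm :
        E →ₗ[F] E × E₁) = A :=
    Submodule.ext fun x => ⟨fun h => h.1, fun h => by
      rw [Subsingleton.elim B ⊤]; exact ⟨h, Submodule.mem_top⟩⟩
  refine isEquivalent_directSum (LinearEquiv.prodUnique (R := F)).symm (fun V A B => ?_)
    (fun V => ⟨V, ⊥, ?_⟩)
  · rw [hc]
    exact M.rank_add_finrank_inf_le V A
  · rw [hc, inf_idem]
    exact le_rfl

theorem isEquivalent_trivial_directSum (M : QMatroid F E) [Unique E₁] :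
    M.IsEquivalent ((trivial F E₁).directSum M) := by
  have hc (A : Submodule F E) (B : Submodule F E₁) :
      (B.prod A).comap ((LinearEquiv.uniqueProd (R := F) (M := E) (M₂ := E₁)).symm :
        E →ₗ[F] E₁ × E) = A :=
    Submodule.ext fun x => ⟨fun h => h.2, fun h => by
      rw [Subsingleton.elim B ⊤]; exact ⟨Submodule.mem_top, h⟩⟩
  refine isEquivalent_directSum (LinearEquiv.uniqueProd (R := F)).symm (fun V B A => ?_)
    (fun V => ⟨⊥, V, ?_⟩)
  · rw [hc]
    have := M.rank_add_finrank_inf_le V A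
    change _ ≤ 0 + _ + _
    omega
  · rw [hc, inf_idem]
    change 0 + _ + _ ≤ _
    omega

theorem isEquivalent_directSum_assoc (M₁ : QMatroid F E₁) (M₂ : QMatroid F E₂)
    (M₃ : QMatroid F E₃) :
    ((M₁.directSum M₂).directSum M₃).IsEquivalent (M₁.directSum (M₂.directSum M₃)) := by
  have hc (A : Submodule F E₁) (B : Submodule F E₂) (C : Submodule F E₃) :
      (A.prod (B.prod C)).comap (LinearEquiv.prodAssoc F E₁ E₂ E₃ :
        (E₁ × E₂) × E₃ →ₗ[F] E₁ × E₂ × E₃) = (A.prod B).prod C :=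
    Submodule.ext fun x => and_assoc.symm
  refine isEquivalent_directSum (LinearEquiv.prodAssoc F E₁ E₂ E₃) (fun V A B => ?_) (fun V => ?_)
  · obtain ⟨B', C', hB⟩ := exists_le_directSum_rank M₂ M₃ B
    have h1 := directSum_rank_le (M₁.directSum M₂) M₃ (A.prod B') C' V
    have h2 := directSum_rank_prod_le M₁ M₂ A B'
    -- The factor `B` is shrunk to `B ⊓ B'.prod C'`; the loss of dimension is paid for by `hB`.
    have h3 := V.finrank_inf_add_finrank_le (Submodule.comap_mono
      (f := (LinearEquiv.prodAssoc F E₁ E₂ E₃ : (E₁ × E₂) × E₃ →ₗ[F] E₁ × E₂ × E₃))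
      (Submodule.prod_mono (le_refl A) (inf_le_left : B ⊓ B'.prod C' ≤ B)))
    have h4 := Submodule.finrank_mono (inf_le_inf_left V ((Submodule.comap_mono
      (f := (LinearEquiv.prodAssoc F E₁ E₂ E₃ : (E₁ × E₂) × E₃ →ₗ[F] E₁ × E₂ × E₃))
      (Submodule.prod_mono (le_refl A) (inf_le_right : B ⊓ B'.prod C' ≤ _))).trans
        (hc A B' C').le))
    rw [LinearEquiv.finrank_comap_eq, LinearEquiv.finrank_comap_eq, Submodule.finrank_prod_eq,
      Submodule.finrank_prod_eq] at h3
    omega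
  · obtain ⟨A, C, hA⟩ := exists_le_directSum_rank (M₁.directSum M₂) M₃ V
    obtain ⟨A', B', hA'⟩ := exists_le_directSum_rank M₁ M₂ A
    refine ⟨A', B'.prod C, ?_⟩
    rw [hc]
    have h1 := directSum_rank_prod_le M₂ M₃ B' C
    have h3 := V.finrank_inf_add_finrank_le
      (Submodule.prod_mono (inf_le_left : A ⊓ A'.prod B' ≤ A) (le_refl C))
    have h4 := Submodule.finrank_mono (inf_le_inf_left V
      (Submodule.prod_mono (inf_le_right : A ⊓ A'.prod B' ≤ _) (le_refl C)))
    rw [Submodule.finrank_prod_eq, Submodule.finrank_prod_eq] at h3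
    omega

/-! ### From external to internal direct sums -/

/-- An injective linear map of the ground spaces that preserves ranks. -/
structure IsEmbedding (N : QMatroid F E₁) (M : QMatroid F E) (f : E₁ →ₗ[F] E) : Prop where
  injective : Function.Injective f
  rank_map : ∀ V, M.rank (V.map f) = N.rank V

/-- The sum map `C × D → E` is injective with the same range as `f`, which identifies `X` with `C ×
D`. One rank inequality is subadditivity, the other is the separation. -/
theorem isReducible_of_separates {F : Type u} [Field F] {X : Type v} [AddCommGroup X] [Module F X]
    [FiniteDimensional F X] {E : Type v} [AddCommGroup E] [Module F E] [FiniteDimensional F E]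
    {N : QMatroid F X} {M : QMatroid F E} {f : X →ₗ[F] E} (hf : IsEmbedding N M f)
    {C D : Submodule F E} (hsup : C ⊔ D = LinearMap.range f) (hCD : Disjoint C D)
    (hs : M.Separates C D) (hC : C ≠ ⊥) (hD : D ≠ ⊥) : N.IsReducible := by
  have hg : Function.Injective (C.subtype.coprod D.subtype) := by
    rw [← LinearMap.ker_eq_bot, LinearMap.ker_coprod_of_disjoint_range]
    · simp
    · simpa using hCD
  obtain ⟨e, he⟩ := LinearMap.exists_linearEquiv_of_range_eq hf.injective hg
    (by rw [LinearMap.range_coprod, Submodule.range_subtype, Submodule.range_subtype, hsup])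
  have he' (x : X) : ((e x).1 : E) + (e x).2 = f x := LinearMap.congr_fun he x
  -- The pullback along an inclusion is the restriction.
  refine ⟨C, D, inferInstance, inferInstance, inferInstance, inferInstance, inferInstance,
    inferInstance, M.pullback C.subtype, M.pullback D.subtype,
    (Submodule.nontrivial_iff_ne_bot).2 hC, (Submodule.nontrivial_iff_ne_bot).2 hD,
    isEquivalent_directSum e (fun V A B => ?_) (fun V => ?_)⟩
  · change _ ≤ M.rank (A.map C.subtype) + M.rank (B.map D.subtype) + _
    have h1 := N.rank_add_finrank_inf_le V ((A.prod B).comap (e : X →ₗ[F] C × D))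
    have h2 : ((A.prod B).comap (e : X →ₗ[F] C × D)).map f ≤
        A.map C.subtype ⊔ B.map D.subtype := by
      rintro _ ⟨x, hx, rfl⟩
      rw [← he' x]
      exact Submodule.add_mem_sup ⟨_, hx.1, rfl⟩ ⟨_, hx.2, rfl⟩
    have h3 := M.rank_mono _ _ h2
    have h4 := M.rank_sup_le (A.map C.subtype) (B.map D.subtype)
    rw [hf.rank_map] at h3
    omega
  · obtain ⟨C', hC', D', hD', h⟩ := hs (V.map f) (hsup ▸ LinearMap.map_le_range)
    refine ⟨C'.comap C.subtype, D'.comap D.subtype, ?_⟩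
    change M.rank ((C'.comap C.subtype).map C.subtype) +
      M.rank ((D'.comap D.subtype).map D.subtype) + _ ≤ _
    rw [Submodule.map_comap_subtype, Submodule.map_comap_subtype, inf_eq_right.2 hC',
      inf_eq_right.2 hD']
    rw [hf.rank_map, LinearMap.finrank_map_eq_of_injective hf.injective] at h
    refine h.trans (Nat.add_le_add_left ?_ _)
    have h1 : V.map f ⊓ (C' ⊔ D') ≤ (V ⊓ ((C'.comap C.subtype).prod (D'.comap D.subtype)).comap
        (e : X →ₗ[F] C × D)).map f := by
      rintro _ ⟨⟨x, hx, rfl⟩, hx'⟩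
      obtain ⟨c, hc, d, hd, hcd⟩ := Submodule.mem_sup.1 hx'
      have h2 : e x = (⟨c, hC' hc⟩, ⟨d, hD' hd⟩) :=
        hg ((he' x).trans hcd.symm)
      refine ⟨x, ⟨hx, ?_⟩, rfl⟩
      change e x ∈ (C'.comap C.subtype).prod (D'.comap D.subtype)
      rw [h2]
      exact ⟨hc, hd⟩
    exact (Submodule.finrank_mono h1).trans (Submodule.finrank_map_le f _)

theorem IsIrreducible.isInseparable {F : Type u} [Field F] {X : Type v} [AddCommGroup X]
    [Module F X] [FiniteDimensional F X] {E : Type v} [AddCommGroup E] [Module F E]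
    [FiniteDimensional F E] {N : QMatroid F X} {M : QMatroid F E} {f : X →ₗ[F] E}
    (hN : N.IsIrreducible) (hf : IsEmbedding N M f) : M.IsInseparable (LinearMap.range f) := by
  intro C D hsup hCD hs
  by_contra! h
  exact hN (isReducible_of_separates hf hsup hCD hs h.1 h.2)

theorem isEmbedding_inl (M₁ : QMatroid F E₁) (M₂ : QMatroid F E₂) :
    IsEmbedding M₁ (M₁.directSum M₂) (LinearMap.inl F E₁ E₂) := by
  refine ⟨LinearMap.inl_injective, fun V => le_antisymm ?_ ?_⟩
  · rw [Submodule.map_inl]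
    simpa [rank_bot] using directSum_rank_prod_le M₁ M₂ V ⊥
  · obtain ⟨A, B, h⟩ := exists_le_directSum_rank M₁ M₂ (V.map (LinearMap.inl F E₁ E₂))
    have h1 := M₁.rank_add_finrank_inf_le V A
    have h2 : V.map (LinearMap.inl F E₁ E₂) ⊓ A.prod B ≤
        (V ⊓ A).map (LinearMap.inl F E₁ E₂) := by
      rintro _ ⟨⟨x, hx, rfl⟩, hx'⟩
      exact ⟨x, ⟨hx, hx'.1⟩, rfl⟩
    have h3 := Submodule.finrank_mono h2
    rw [LinearMap.finrank_map_eq_of_injective LinearMap.inl_injective] at h3 h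
    omega

theorem isEmbedding_inr (M₁ : QMatroid F E₁) (M₂ : QMatroid F E₂) :
    IsEmbedding M₂ (M₁.directSum M₂) (LinearMap.inr F E₁ E₂) := by
  refine ⟨LinearMap.inr_injective, fun V => le_antisymm ?_ ?_⟩
  · rw [Submodule.map_inr]
    simpa [rank_bot] using directSum_rank_prod_le M₁ M₂ ⊥ V
  · obtain ⟨A, B, h⟩ := exists_le_directSum_rank M₁ M₂ (V.map (LinearMap.inr F E₁ E₂))
    have h1 := M₂.rank_add_finrank_inf_le V B
    have h2 : V.map (LinearMap.inr F E₁ E₂) ⊓ A.prod B ≤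
        (V ⊓ B).map (LinearMap.inr F E₁ E₂) := by
      rintro _ ⟨⟨x, hx, rfl⟩, hx'⟩
      exact ⟨x, ⟨hx, hx'.2⟩, rfl⟩
    have h3 := Submodule.finrank_mono h2
    rw [LinearMap.finrank_map_eq_of_injective LinearMap.inr_injective] at h3 h
    omega

omit [FiniteDimensional F E] [FiniteDimensional F E₁] [FiniteDimensional F E₂] in
theorem IsEmbedding.comp {M₁ : QMatroid F E₁} {M₂ : QMatroid F E₂} {M : QMatroid F E}
    {g : E₂ →ₗ[F] E} {f : E₁ →ₗ[F] E₂} (hg : IsEmbedding M₂ M g) (hf : IsEmbedding M₁ M₂ f) :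
    IsEmbedding M₁ M (g ∘ₗ f) :=
  ⟨hg.injective.comp hf.injective, fun V => by
    rw [Submodule.map_comp, hg.rank_map, hf.rank_map]⟩

theorem IsInternalSum.directSum_finCons (M₁ : QMatroid F E₁) {M₂ : QMatroid F E₂} {n : ℕ}
    {B : Fin n → Submodule F E₂} (hB : M₂.IsInternalSum B) :
    (M₁.directSum M₂).IsInternalSum (Fin.cons (LinearMap.range (LinearMap.inl F E₁ E₂))
      (fun i => (B i).map (LinearMap.inr F E₁ E₂)) : Fin (n + 1) → Submodule F (E₁ × E₂)) := by
  have hcons (A : Submodule F E₁) (B : Fin n → Submodule F E₂) :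
      ⨆ i, (Fin.cons (A.map (LinearMap.inl F E₁ E₂))
        (fun i => (B i).map (LinearMap.inr F E₁ E₂)) : Fin (n + 1) → Submodule F (E₁ × E₂)) i =
          A.prod (⨆ i, B i) := by
    rw [LinearMap.prod_eq_sup_map, Submodule.map_iSup]
    refine le_antisymm (iSup_le (Fin.cases le_sup_left fun i => le_sup_of_le_right
      (le_iSup (fun i => (B i).map (LinearMap.inr F E₁ E₂)) i))) (sup_le ?_ (iSup_le fun i => ?_))
    · exact le_iSup (Fin.cons (A.map (LinearMap.inl F E₁ E₂))
        (fun i => (B i).map (LinearMap.inr F E₁ E₂)) : Fin (n + 1) → Submodule F (E₁ × E₂)) 0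
    · exact le_iSup (Fin.cons (A.map (LinearMap.inl F E₁ E₂))
        (fun i => (B i).map (LinearMap.inr F E₁ E₂)) : Fin (n + 1) → Submodule F (E₁ × E₂)) i.succ
  refine ⟨iSupIndep_finCons (LinearMap.iSupIndep_map _ LinearMap.inr_injective hB.indep) ?_, ?_,
    fun V => ?_⟩
  · rw [← Submodule.map_iSup, hB.iSup_eq_top, Submodule.map_top]
    exact LinearMap.isCompl_range_inl_inr.disjoint
  · rw [← Submodule.map_top, hcons, hB.iSup_eq_top, Submodule.prod_top]
  · obtain ⟨A, C, h⟩ := exists_le_directSum_rank M₁ M₂ V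
    obtain ⟨B', hB', h'⟩ := hB.exists_le C
    refine ⟨Fin.cons (A.map (LinearMap.inl F E₁ E₂))
      (fun i => (B' i).map (LinearMap.inr F E₁ E₂)),
      Fin.cases LinearMap.map_le_range fun i => Submodule.map_mono (hB' i), ?_⟩
    · rw [hcons, Fin.sum_univ_succ]
      simp only [Fin.cons_zero, Fin.cons_succ, (isEmbedding_inl M₁ M₂).rank_map,
        (isEmbedding_inr M₁ M₂).rank_map]
      have h3 := V.finrank_inf_add_finrank_le
        (Submodule.prod_mono (le_refl A) (inf_le_left : C ⊓ ⨆ i, B' i ≤ C))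
      have h4 := Submodule.finrank_mono (inf_le_inf_left V
        (Submodule.prod_mono (le_refl A) (inf_le_right : C ⊓ ⨆ i, B' i ≤ _)))
      rw [Submodule.finrank_prod_eq, Submodule.finrank_prod_eq] at h3
      omega

omit [FiniteDimensional F E] [FiniteDimensional F E₁] in
theorem IsInternalSum.map {M : QMatroid F E} {M₁ : QMatroid F E₁} {ι : Type*} [Fintype ι]
    {A : ι → Submodule F E₁} (hA : M₁.IsInternalSum A) (α : E₁ ≃ₗ[F] E)
    (hα : ∀ V, M.rank (V.map (α : E₁ →ₗ[F] E)) = M₁.rank V) :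
    M.IsInternalSum (fun i => (A i).map (α : E₁ →ₗ[F] E)) := by
  refine ⟨LinearMap.iSupIndep_map _ α.injective hA.indep, ?_, fun V => ?_⟩
  · rw [← Submodule.map_iSup, hA.iSup_eq_top, Submodule.map_top, LinearEquiv.range]
  · obtain ⟨A', hA', h⟩ := hA.exists_le (V.comap (α : E₁ →ₗ[F] E))
    refine ⟨fun i => (A' i).map (α : E₁ →ₗ[F] E), fun i => Submodule.map_mono (hA' i), ?_⟩
    rw [← hα, ← α.finrank_map_eq, ← α.finrank_map_eq (_ ⊓ _), Submodule.map_inf _ α.injective,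
      Submodule.map_comap_eq_of_surjective α.surjective, Submodule.map_iSup] at h
    simpa only [hα] using h

end QMatroid

/-! ### Iterated direct sums -/

namespace BundledQMatroid

variable {F : Type u} [Field F]

theorem exists_isInternalSum_directSum (L : List (BundledQMatroid.{u, v} F)) :
    ∃ f : ∀ i : Fin L.length, (L.get i).Ground →ₗ[F] (directSum L).Ground,
      (∀ i, QMatroid.IsEmbedding (L.get i).toQMatroid (directSum L).toQMatroid (f i)) ∧
        (directSum L).toQMatroid.IsInternalSum (fun i => LinearMap.range (f i)) := by
  induction L with
  | nil =>
    have : Subsingleton (directSum ([] : List (BundledQMatroid.{u, v} F))).Ground :=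
      inferInstanceAs (Subsingleton PUnit)
    refine ⟨fun i => i.elim0, fun i => i.elim0, fun i => i.elim0, Subsingleton.elim _ _,
      fun V => ⟨fun i => i.elim0, fun i => i.elim0, ?_⟩⟩
    rw [finrank_zero_of_subsingleton]
    exact Nat.zero_le _
  | cons N L ih =>
    obtain ⟨f, hf, h⟩ := ih
    refine ⟨Fin.cases (LinearMap.inl F N.Ground (directSum L).Ground)
      (fun i => LinearMap.inr F N.Ground (directSum L).Ground ∘ₗ f i),
      Fin.cases (QMatroid.isEmbedding_inl _ _)
        (fun i => (QMatroid.isEmbedding_inr _ _).comp (hf i)), ?_⟩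
    refine cast (congrArg (directSum (N :: L)).toQMatroid.IsInternalSum (funext ?_))
      (h.directSum_finCons N.toQMatroid)
    exact Fin.cases rfl fun i => (LinearMap.range_comp _ _).symm

theorem isEquivalent_directSum_append (L L' : List (BundledQMatroid.{u, v} F)) :
    ((directSum L).toQMatroid.directSum (directSum L').toQMatroid).IsEquivalent
      (directSum (L ++ L')).toQMatroid := by
  induction L with
  | nil =>
    exact ((directSum L').toQMatroid.isEquivalent_trivial_directSum (E₁ := PUnit.{v + 1})).symm
  | cons N L ih =>
    exact (QMatroid.isEquivalent_directSum_assoc _ _ _).trans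
      ((QMatroid.IsEquivalent.refl N.toQMatroid).directSum_congr ih)

end BundledQMatroid

/-! ### Existence, and decompositions inside the ground space -/

namespace QMatroid

variable {F : Type u} [Field F] {E : Type v} [AddCommGroup E] [Module F E]

theorem exists_isIrreducibleDecomposition [FiniteDimensional F E] (M : QMatroid F E) :
    ∃ L : List (BundledQMatroid.{u, v} F), M.IsIrreducibleDecomposition L := by
  obtain ⟨n, hn⟩ : ∃ n, finrank F E = n := ⟨_, rfl⟩
  induction n using Nat.strong_induction_on generalizing E with
  | _ n ih =>
    rcases subsingleton_or_nontrivial E with hE | hE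
    -- Dimension 0 is the empty sum; such a q-matroid is not allowed as a summand.
    · refine ⟨[], by simp, (LinearEquiv.ofSubsingleton E PUnit.{v + 1}), fun V => ?_⟩
      have := M.rank_le_finrank V
      rw [finrank_zero_of_subsingleton] at this
      change 0 = _
      omega
    by_cases hM : M.IsIrreducible
    · refine ⟨[⟨E, M⟩], ?_, M.isEquivalent_directSum_trivial (E₁ := PUnit.{v + 1})⟩
      intro N hN
      rw [List.mem_singleton] at hN
      subst hN
      exact ⟨hE, hM⟩
    · obtain ⟨E₁, E₂, _, _, _, _, _, _, M₁, M₂, h₁, h₂, h⟩ := not_not.1 hM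
      have hdim : finrank F E = finrank F E₁ + finrank F E₂ := by
        obtain ⟨α, -⟩ := h
        rw [α.finrank_eq, finrank_prod]
      have hp₁ : 0 < finrank F E₁ := finrank_pos
      have hp₂ : 0 < finrank F E₂ := finrank_pos
      obtain ⟨L₁, hL₁, e₁⟩ := ih (finrank F E₁) (by omega) M₁ rfl
      obtain ⟨L₂, hL₂, e₂⟩ := ih (finrank F E₂) (by omega) M₂ rfl
      refine ⟨L₁ ++ L₂, fun N hN => ?_, h.trans ((e₁.directSum_congr e₂).trans
        (BundledQMatroid.isEquivalent_directSum_append L₁ L₂))⟩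
      exact (List.mem_append.1 hN).elim (hL₁ N) (hL₂ N)

theorem IsIrreducibleDecomposition.exists_isInternalSum [FiniteDimensional F E]
    {M : QMatroid F E} {L : List (BundledQMatroid.{u, v} F)}
    (h : M.IsIrreducibleDecomposition L) :
    ∃ f : ∀ i : Fin L.length, (L.get i).Ground →ₗ[F] E,
      (∀ i, IsEmbedding (L.get i).toQMatroid M (f i)) ∧
        M.IsInternalSum (fun i => LinearMap.range (f i)) ∧
        ∀ i, LinearMap.range (f i) ≠ ⊥ ∧ M.IsInseparable (LinearMap.range (f i)) := by
  obtain ⟨hL, h⟩ := h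
  obtain ⟨α, hα⟩ := h.symm
  obtain ⟨f, hf, hsum⟩ := BundledQMatroid.exists_isInternalSum_directSum L
  have hf' (i : Fin L.length) : IsEmbedding (L.get i).toQMatroid M
      ((α : (BundledQMatroid.directSum L).Ground →ₗ[F] E) ∘ₗ f i) :=
    IsEmbedding.comp ⟨α.injective, hα⟩ (hf i)
  refine ⟨fun i => (α : (BundledQMatroid.directSum L).Ground →ₗ[F] E) ∘ₗ f i, hf', ?_,
    fun i => ⟨fun h0 => ?_, (hL _ (L.get_mem i)).2.isInseparable (hf' i)⟩⟩
  · simpa only [LinearMap.range_comp] using hsum.map α hα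
  · have := (hL _ (L.get_mem i)).1
    obtain ⟨x, hx⟩ := exists_ne (0 : (L.get i).Ground)
    rw [LinearMap.range_eq_bot] at h0
    exact hx ((hf' i).injective ((LinearMap.congr_fun h0 x).trans (map_zero _).symm))

end QMatroid

/-! ### Uniqueness of the summands -/

/-- Used to match lines and larger summands separately, and among the lines those of rank 0 and of
rank 1. -/
theorem Equiv.exists_of_subtype {α β : Type*} {p : α → Prop} {q : β → Prop} {R : α → β → Prop}
    (h₁ : ∃ e : {a // p a} ≃ {b // q b}, ∀ a : {a // p a}, R a (e a))
    (h₂ : ∃ e : {a // ¬ p a} ≃ {b // ¬ q b}, ∀ a : {a // ¬ p a}, R a (e a)) :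
    ∃ e : α ≃ β, ∀ a, R a (e a) := by
  classical
  obtain ⟨e₁, h₁⟩ := h₁
  obtain ⟨e₂, h₂⟩ := h₂
  refine ⟨(Equiv.sumCompl p).symm.trans ((Equiv.sumCongr e₁ e₂).trans (Equiv.sumCompl q)),
    fun a => ?_⟩
  by_cases ha : p a
  · simpa [Equiv.sumCompl_symm_apply_of_pos ha] using h₁ ⟨a, ha⟩
  · simpa [Equiv.sumCompl_symm_apply_of_neg ha] using h₂ ⟨a, ha⟩

theorem LinearMap.mkQ_comp_injective {F X E : Type*} [Field F] [AddCommGroup X] [Module F X]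
    [AddCommGroup E] [Module F E] {f : X →ₗ[F] E} (hf : Function.Injective f)
    {L : Submodule F E} (hL : LinearMap.range f ⊓ L = ⊥) : Function.Injective (L.mkQ ∘ₗ f) := by
  rw [← LinearMap.ker_eq_bot, LinearMap.ker_comp, Submodule.ker_mkQ, eq_bot_iff]
  intro x hx
  have hx0 : f x ∈ (⊥ : Submodule F E) := hL ▸ ⟨⟨x, rfl⟩, hx⟩
  exact hf (((Submodule.mem_bot F).1 hx0).trans (map_zero f).symm)

namespace QMatroid

variable {F : Type u} [Field F]

theorem isEquivalent_of_finrank_eq_one {E₁ E₂ : Type*} [AddCommGroup E₁] [Module F E₁]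
    [AddCommGroup E₂] [Module F E₂] {M₁ : QMatroid F E₁} {M₂ : QMatroid F E₂}
    (h₁ : finrank F E₁ = 1) (h₂ : finrank F E₂ = 1) (h : M₁.rank ⊤ = M₂.rank ⊤) :
    M₁.IsEquivalent M₂ := by
  have : FiniteDimensional F E₁ := Module.finite_of_finrank_pos (by omega)
  have : FiniteDimensional F E₂ := Module.finite_of_finrank_pos (by omega)
  obtain ⟨α⟩ := FiniteDimensional.nonempty_linearEquiv_of_finrank_eq (h₁.trans h₂.symm)
  refine ⟨α, fun V => ?_⟩
  have hat : IsAtom (⊤ : Submodule F E₁) :=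
    Submodule.isAtom_iff_finrank_eq_one.2 (by rw [finrank_top, h₁])
  rcases hat.le_iff.1 (le_top : V ≤ ⊤) with rfl | rfl
  · rw [Submodule.map_bot, rank_bot, rank_bot]
  · rw [Submodule.map_top, LinearEquiv.range, h]

variable {E : Type v} [AddCommGroup E] [Module F E] [FiniteDimensional F E]

/-- Two complements of the loops in the same subspace are equivalent. -/
theorem isEquivalent_of_sup_loops_eq {E₁ E₂ : Type*} [AddCommGroup E₁] [Module F E₁]
    [AddCommGroup E₂] [Module F E₂] {M : QMatroid F E} {M₁ : QMatroid F E₁} {M₂ : QMatroid F E₂}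
    {f : E₁ →ₗ[F] E} {g : E₂ →ₗ[F] E} (hf : IsEmbedding M₁ M f) (hg : IsEmbedding M₂ M g)
    (hfL : LinearMap.range f ⊓ M.loops = ⊥) (hgL : LinearMap.range g ⊓ M.loops = ⊥)
    (h : LinearMap.range f ⊔ M.loops = LinearMap.range g ⊔ M.loops) : M₁.IsEquivalent M₂ := by
  have hmap (X Y : Submodule F E) (hXY : X.map M.loops.mkQ = Y.map M.loops.mkQ) :
      X ⊔ M.loops = Y ⊔ M.loops := by
    have := congrArg (Submodule.comap M.loops.mkQ) hXY
    rwa [Submodule.comap_map_mkQ, Submodule.comap_map_mkQ, sup_comm, sup_comm M.loops] at this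
  have hmap' (X : Submodule F E) : X.map M.loops.mkQ = (X ⊔ M.loops).map M.loops.mkQ := by
    rw [Submodule.map_sup, Submodule.mkQ_map_self, sup_bot_eq]
  -- Modulo the loops, `f` and `g` stay injective and have equal ranges; the resulting `e` moves
  -- images in `E` only by loops.
  obtain ⟨e, he⟩ := LinearMap.exists_linearEquiv_of_range_eq
    (LinearMap.mkQ_comp_injective hf.injective hfL)
    (LinearMap.mkQ_comp_injective hg.injective hgL) (by
      rw [LinearMap.range_comp, LinearMap.range_comp, hmap' (LinearMap.range f), h, ← hmap'])
  refine ⟨e, fun V => ?_⟩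
  have h1 := hmap (V.map f) ((V.map (e : E₁ →ₗ[F] E₂)).map g) (by
    rw [← Submodule.map_comp, ← he, ← Submodule.map_comp, ← Submodule.map_comp])
  rw [← hf.rank_map, ← hg.rank_map, ← M.rank_sup_loops, ← h1, M.rank_sup_loops]

namespace IsInternalSum

variable {M : QMatroid F E} {ι κ : Type*} [Fintype ι] [Fintype κ] {A : ι → Submodule F E}
  {B : κ → Submodule F E}

omit [Fintype ι] in
theorem rank_ne_zero_of_not_isAtom (hI : ∀ i, A i ≠ ⊥ ∧ M.IsInseparable (A i)) {i : ι}
    (hi : ¬ IsAtom (A i)) : M.rank (A i) ≠ 0 := by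
  intro h0
  obtain ⟨hL, -⟩ := ((hI i).2.isAtom_or (hI i).1).resolve_left (fun h => hi h.1)
  rw [inf_eq_left.2 (le_loops h0)] at hL
  exact (hI i).1 hL

theorem exists_sup_loops_le (hB : M.IsInternalSum B) (hA : M.IsInternalSum A)
    (hIA : ∀ i, A i ≠ ⊥ ∧ M.IsInseparable (A i)) {i : ι} (hi : ¬ IsAtom (A i)) :
    ∃ j, ¬ IsAtom (B j) ∧ A i ≤ B j ⊔ M.loops := by
  obtain ⟨hL, hc⟩ := ((hIA i).2.isAtom_or (hIA i).1).resolve_left (fun h => hi h.1)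
  have hc' := hc.sup_loops hL
  obtain ⟨j, hj, hle, hat⟩ := hB.exists_le_sup_loops (hIA i).2 (hIA i).1 hL hc'
    (hA.isFlat_sup_loops i)
  refine ⟨j, fun h => ?_, hle⟩
  -- If `B j` were a line, the loops would be a subspace of codimension at most 1 in the cyclic
  -- space `A i ⊔ M.loops`, with smaller rank.
  have heq : A i ⊔ M.loops = B j ⊔ M.loops :=
    le_antisymm (sup_le hle le_sup_right) (sup_le (hat h) le_sup_right)
  have h1 := hc' M.loops (by
    rw [heq]
    exact lt_of_le_of_ne le_sup_right fun h => hj (le_sup_left.trans h.ge))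
  have h2 : M.rank (B j) ≠ 0 := fun h => hj (le_loops h)
  have h3 := Submodule.finrank_add_le_finrank_add_finrank (B j) M.loops
  rw [heq, rank_sup_loops, rank_loops] at h1
  rw [Submodule.isAtom_iff_finrank_eq_one.1 h] at h3
  omega

/-- Going from `A` to `B` and back ends in a summand that contains `A i` modulo loops, which can
only be `A i`. -/
theorem exists_sup_loops_eq (hB : M.IsInternalSum B) (hA : M.IsInternalSum A)
    (hIA : ∀ i, A i ≠ ⊥ ∧ M.IsInseparable (A i)) (hIB : ∀ j, B j ≠ ⊥ ∧ M.IsInseparable (B j))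
    {i : ι} (hi : ¬ IsAtom (A i)) :
    ∃ j, ¬ IsAtom (B j) ∧ A i ⊔ M.loops = B j ⊔ M.loops := by
  obtain ⟨j, hj, hij⟩ := hB.exists_sup_loops_le hA hIA hi
  obtain ⟨k, hk, hjk⟩ := hA.exists_sup_loops_le hB hIB hj
  have hik : i = k := hA.eq_of_le_sup_loops (rank_ne_zero_of_not_isAtom hIA hi)
    (hij.trans (sup_le hjk le_sup_right))
  exact ⟨j, hj, le_antisymm (sup_le hij le_sup_right) (sup_le (hik ▸ hjk) le_sup_right)⟩

/-- The summands without loops and coloops of two decompositions agree modulo the loops. -/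
theorem exists_equiv_not_isAtom (hB : M.IsInternalSum B) (hA : M.IsInternalSum A)
    (hIA : ∀ i, A i ≠ ⊥ ∧ M.IsInseparable (A i)) (hIB : ∀ j, B j ≠ ⊥ ∧ M.IsInseparable (B j)) :
    ∃ e : {i // ¬ IsAtom (A i)} ≃ {j // ¬ IsAtom (B j)},
      ∀ i : {i // ¬ IsAtom (A i)}, A i ⊔ M.loops = B (e i) ⊔ M.loops := by
  choose φ hφ hφ' using fun i : {i // ¬ IsAtom (A i)} => hB.exists_sup_loops_eq hA hIA hIB i.2
  refine ⟨Equiv.ofBijective (fun i => ⟨φ i, hφ i⟩) ⟨fun i k hik => ?_, fun j => ?_⟩, hφ'⟩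
  · have h1 : φ i = φ k := congrArg Subtype.val hik
    refine Subtype.ext (hA.eq_of_le_sup_loops (rank_ne_zero_of_not_isAtom hIA i.2) ?_)
    rw [hφ' k, ← h1, ← hφ' i]
    exact le_sup_left
  · obtain ⟨i, hi, hij⟩ := hA.exists_sup_loops_eq hB hIB hIA j.2
    refine ⟨⟨i, hi⟩, Subtype.ext ?_⟩
    refine (hB.eq_of_le_sup_loops (rank_ne_zero_of_not_isAtom hIB j.2) ?_).symm
    rw [← hφ' ⟨i, hi⟩, ← hij]
    exact le_sup_left

/-- The loops are the sum of their traces on the `A i`; such a trace is all of a rank-0 line and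
zero on any other summand. -/
theorem finrank_loops_eq_card (hA : M.IsInternalSum A)
    (hIA : ∀ i, A i ≠ ⊥ ∧ M.IsInseparable (A i)) :
    finrank F M.loops = Nat.card {i // IsAtom (A i) ∧ M.rank (A i) = 0} := by
  classical
  rw [hA.finrank_loops_eq_sum, Nat.card_eq_fintype_card, Fintype.card_subtype,
    Finset.card_filter]
  refine Finset.sum_congr rfl fun i _ => ?_
  split_ifs with h
  · rw [inf_eq_right.2 (le_loops h.2)]
    exact Submodule.isAtom_iff_finrank_eq_one.1 h.1
  · suffices A i ⊓ M.loops = ⊥ by rw [inf_comm, this, finrank_bot]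
    rcases (hIA i).2.isAtom_or (hIA i).1 with h' | h'
    · refine (h'.1.le_iff.1 (inf_le_left : A i ⊓ M.loops ≤ _)).resolve_right fun h0 => ?_
      exact h ⟨h'.1, le_loops_iff.1 (inf_eq_left.1 h0)⟩
    · exact h'.1

theorem finrank_eq_sum_add_card (hA : M.IsInternalSum A) :
    finrank F E = ∑ᶠ i : {i // ¬ IsAtom (A i)}, finrank F (A i) +
      Nat.card {i // IsAtom (A i)} := by
  classical
  rw [hA.finrank_eq_sum, finsum_eq_sum_of_fintype, Nat.card_eq_fintype_card,
    ← Fintype.sum_subtype_add_sum_subtype (fun i => IsAtom (A i)), add_comm,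
    Fintype.card_eq_sum_ones]
  congr 1
  exact Finset.sum_congr rfl fun i _ => Submodule.isAtom_iff_finrank_eq_one.1 i.2

/-- Two decompositions have the same numbers of loops and of coloops. -/
theorem exists_equiv_isAtom (hB : M.IsInternalSum B) (hA : M.IsInternalSum A)
    (hIA : ∀ i, A i ≠ ⊥ ∧ M.IsInseparable (A i)) (hIB : ∀ j, B j ≠ ⊥ ∧ M.IsInseparable (B j)) :
    ∃ e : {i // IsAtom (A i)} ≃ {j // IsAtom (B j)},
      ∀ i : {i // IsAtom (A i)}, M.rank (A i) = M.rank (B (e i)) := by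
  classical
  have hl : Nat.card {i : {i // IsAtom (A i)} // M.rank (A i) = 0} =
      Nat.card {j : {j // IsAtom (B j)} // M.rank (B j) = 0} := by
    rw [Nat.card_congr (Equiv.subtypeSubtypeEquivSubtypeInter (fun i => IsAtom (A i))
      (fun i => M.rank (A i) = 0)), Nat.card_congr (Equiv.subtypeSubtypeEquivSubtypeInter
      (fun i => IsAtom (B i)) (fun i => M.rank (B i) = 0)), ← hA.finrank_loops_eq_card hIA,
      ← hB.finrank_loops_eq_card hIB]
  have ht : Nat.card {i // IsAtom (A i)} = Nat.card {j // IsAtom (B j)} := by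
    obtain ⟨e, he⟩ := hB.exists_equiv_not_isAtom hA hIA hIB
    have h1 := hA.finrank_eq_sum_add_card
    rw [hB.finrank_eq_sum_add_card] at h1
    -- Matched larger summands are complements of the loops in the same space, hence of equal
    -- dimension.
    suffices ∑ᶠ i : {i // ¬ IsAtom (A i)}, finrank F (A i) =
        ∑ᶠ j : {j // ¬ IsAtom (B j)}, finrank F (B j) by omega
    rw [← finsum_comp_equiv e]
    refine finsum_congr fun i => ?_
    have hi := (((hIA i).2.isAtom_or (hIA i).1).resolve_left (fun h => i.2 h.1)).1
    have hj := (((hIB (e i)).2.isAtom_or (hIB (e i)).1).resolve_left (fun h => (e i).2 h.1)).1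
    have h2 := Submodule.finrank_sup_add_finrank_inf_eq (A i) M.loops
    have h3 := Submodule.finrank_sup_add_finrank_inf_eq (B (e i)) M.loops
    rw [hi, he] at h2
    rw [hj] at h3
    omega
  have hone {n : ℕ} (h : n ≤ 1) (h0 : n ≠ 0) : n = 1 := by omega
  have hle (V : Submodule F E) (hV : IsAtom V) : M.rank V ≤ 1 :=
    (M.rank_le_finrank V).trans_eq (Submodule.isAtom_iff_finrank_eq_one.1 hV)
  refine Equiv.exists_of_subtype (p := fun i : {i // IsAtom (A i)} => M.rank (A i) = 0)
    (q := fun j : {j // IsAtom (B j)} => M.rank (B j) = 0)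
    (R := fun i j => M.rank (A i) = M.rank (B j)) ?_ ?_
  · obtain ⟨e⟩ := Finite.card_eq.1 hl
    exact ⟨e, fun i => i.2.trans (e i).2.symm⟩
  · have hc : Nat.card {i : {i // IsAtom (A i)} // ¬ M.rank (A i) = 0} =
        Nat.card {j : {j // IsAtom (B j)} // ¬ M.rank (B j) = 0} := by
      simp only [Nat.card_eq_fintype_card] at hl ht ⊢
      rw [Fintype.card_subtype_compl, Fintype.card_subtype_compl, hl, ht]
    obtain ⟨e⟩ := Finite.card_eq.1 hc
    refine ⟨e, fun i => ?_⟩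
    rw [hone (hle _ i.1.2) i.2, hone (hle _ (e i).1.2) (e i).2]

end IsInternalSum

theorem IsIrreducibleDecomposition.exists_equiv {M : QMatroid F E}
    {L L' : List (BundledQMatroid.{u, v} F)} (h : M.IsIrreducibleDecomposition L)
    (h' : M.IsIrreducibleDecomposition L') :
    ∃ σ : Fin L.length ≃ Fin L'.length, ∀ i : Fin L.length,
      (L.get i).toQMatroid.IsEquivalent (L'.get (σ i)).toQMatroid := by
  obtain ⟨f, hf, hA, hIA⟩ := h.exists_isInternalSum
  obtain ⟨g, hg, hB, hIB⟩ := h'.exists_isInternalSum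
  refine Equiv.exists_of_subtype (p := fun i => IsAtom (LinearMap.range (f i)))
    (q := fun j => IsAtom (LinearMap.range (g j)))
    (R := fun i j => (L.get i).toQMatroid.IsEquivalent (L'.get j).toQMatroid) ?_ ?_
  · obtain ⟨e, he⟩ := hB.exists_equiv_isAtom hA hIA hIB
    refine ⟨e, fun i => isEquivalent_of_finrank_eq_one ?_ ?_ ?_⟩
    · rw [← LinearMap.finrank_range_of_inj (hf i).injective]
      exact Submodule.isAtom_iff_finrank_eq_one.1 i.2
    · rw [← LinearMap.finrank_range_of_inj (hg (e i)).injective]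
      exact Submodule.isAtom_iff_finrank_eq_one.1 (e i).2
    · rw [← (hf i).rank_map, ← (hg (e i)).rank_map, Submodule.map_top, Submodule.map_top, he i]
  · obtain ⟨e, he⟩ := hB.exists_equiv_not_isAtom hA hIA hIB
    refine ⟨e, fun i => isEquivalent_of_sup_loops_eq (hf i) (hg (e i)) ?_ ?_ (he i)⟩
    · exact (((hIA i).2.isAtom_or (hIA i).1).resolve_left (fun h => i.2 h.1)).1
    · exact (((hIB (e i)).2.isAtom_or (hIB (e i)).1).resolve_left (fun h => (e i).2 h.1)).1

end QMatroid

theorem mainTheorem2 {F : Type u} [Field F] [Finite F] {E : Type v} [AddCommGroup E] [Module F E]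
    [FiniteDimensional F E] (M : QMatroid F E) :
    (∃ L : List (BundledQMatroid.{u, v} F), M.IsIrreducibleDecomposition L) ∧
      ∀ L L' : List (BundledQMatroid.{u, v} F),
        M.IsIrreducibleDecomposition L → M.IsIrreducibleDecomposition L' →
          ∃ σ : Fin L.length ≃ Fin L'.length, ∀ i : Fin L.length,
            (L.get i).toQMatroid.IsEquivalent (L'.get (σ i)).toQMatroid :=
  ⟨M.exists_isIrreducibleDecomposition, fun _ _ h h' => h.exists_equiv h'⟩
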